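/- Let $\mathcal P\subset\mathbb R^d$ be a polytope (the convex hull of a nonempty finite set) with at least two points. Let $D=\max\{\|x-y\|:x,y\in\mathcal P\}$ be its diameter and let $$W=\min_{\ell\in U,\ \|\ell\|=1}\ \max\{\ell\cdot(x-y):x,y\in\mathcal P\}$$ be its width, where $U$ is the direction space of the affine hull of $\mathcal P$. Let $a_1,a_2,\dots$ be i.i.d. integrable random vectors in $\mathbb R^d$ with mean $a=\mathbb E[a_n]$, and let $L_\infty>0$ and $R_\infty$ be such that almost surely, for all $n$ and all $x,y\in\mathcal P$, $$|a_n\cdot(x-y)|\le L_\infty,\qquad |(a_n-a)\cdot(x-y)|\le R_\infty .$$ Let $x^*\in\mathrm{argmin}\{a\cdot x:x\in\mathcal P\}$ and let $\Delta$ be the smallest positive value of $a\cdot(v-x^*)$ over the vertices $v$ of $\mathcal P$ (if there is none, put $\Delta=\infty$, $1/\Delta=0$). For $y_1\in\mathcal P$ and $\eta=DW/(2L_\infty)$ let $x_n$ be the actions of the lazy, anytime Subgradient algorithm: $x_1=P_{\mathcal P}(y_1)$ and $$x_{n+1}=P_{\mathcal P}\Big(y_1-\eta\,\frac{a_1+\dots+a_n}{\sqrt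 n}\Big)\quad(n\ge1),$$ where $P_{\mathcal P}$ is the Euclidean projection onto $\mathcal P$. Then $\sum_{i\ge1}a\cdot(x_i-x^*)$ converges almost surely, is integrable, and $$\mathbb E\Big[\sum_{i=1}^\infty a\cdot(x_i-x^*)\Big]\le\Big(\frac{2L_\infty D}{W}+\sqrt{\frac{\pi}{2}}\,\frac{R_\infty D}{W}\Big)\Big(\frac{30L_\infty D}{W\Delta}+\frac13\Big)+\frac{15R_\infty^2D^2}{W^2\Delta}.$$ In particular the pseudo-regret is $O\big(L_\infty^2D^2/(W^2\Delta)\big)$ with an absolute constant: it is at most $200\,L_\infty^2D^2/(W^2\Delta)$. -/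

import Mathlib

open MeasureTheory ProbabilityTheory

noncomputable section

/-- A polytope in `ℝ^d`: the convex hull of a nonempty finite set of points. -/
def IsPolytope {d : ℕ} (P : Set (EuclideanSpace ℝ (Fin d))) : Prop :=
  ∃ V : Finset (EuclideanSpace ℝ (Fin d)), V.Nonempty ∧
    P = convexHull ℝ (V : Set (EuclideanSpace ℝ (Fin d)))

/-- The extent `max {ℓ · (x - y) : x, y ∈ P}` of `P` in direction `ℓ`. -/
def directionalWidth {d : ℕ} (P : Set (EuclideanSpace ℝ (Fin d)))
    (ℓ : EuclideanSpace ℝ (Fin d)) : ℝ :=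
  sSup {w : ℝ | ∃ x ∈ P, ∃ y ∈ P, w = inner ℝ ℓ (x - y)}

/-- The width of `P` within its affine hull: the least extent of `P` in a unit direction `ℓ`
belonging to the direction space of the affine hull of `P`. -/
def polytopeWidth {d : ℕ} (P : Set (EuclideanSpace ℝ (Fin d))) : ℝ :=
  sInf {w : ℝ | ∃ ℓ ∈ (affineSpan ℝ P).direction, ‖ℓ‖ = 1 ∧ w = directionalWidth P ℓ}

/-- `q` minimises the linear function `x ↦ a · x` over `P`. -/
def IsLinearMinimizer {d : ℕ} (P : Set (EuclideanSpace ℝ (Fin d)))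
    (a q : EuclideanSpace ℝ (Fin d)) : Prop :=
  q ∈ P ∧ ∀ z ∈ P, (inner ℝ a q : ℝ) ≤ inner ℝ a z

/-- The suboptimality gap: the least positive value of `a · (v - v*)` over vertices `v` of `P`,
where `v*` is an optimal vertex. If all vertices are optimal there is no such value; the
infimum is then `0`, so that `1 / Δ = 0` in Lean, in accordance with `Δ = ∞`. -/
def suboptimalityGap {d : ℕ} (P : Set (EuclideanSpace ℝ (Fin d)))
    (a : EuclideanSpace ℝ (Fin d)) : ℝ :=
  sInf {g : ℝ | ∃ v ∈ P.extremePoints ℝ, ∃ w ∈ P.extremePoints ℝ,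
    IsLinearMinimizer P a w ∧ g = inner ℝ a (v - w) ∧ 0 < g}

/-- `q` is a point of `X` nearest to `p` in Euclidean distance. -/
def IsNearestPoint {d : ℕ} (X : Set (EuclideanSpace ℝ (Fin d)))
    (p q : EuclideanSpace ℝ (Fin d)) : Prop :=
  q ∈ X ∧ ∀ z ∈ X, ‖q - p‖ ≤ ‖z - p‖

/-- The Euclidean projection of `p` onto `X`. -/
def euclideanProj {d : ℕ} (X : Set (EuclideanSpace ℝ (Fin d)))
    (p : EuclideanSpace ℝ (Fin d)) : EuclideanSpace ℝ (Fin d) :=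
  Classical.epsilon (IsNearestPoint X p)

/-- A nonempty compact set has a nearest point to every `p`, so the projection is one. -/
theorem euclideanProj_spec {d : ℕ} {X : Set (EuclideanSpace ℝ (Fin d))}
    (hc : IsCompact X) (hn : X.Nonempty) (p : EuclideanSpace ℝ (Fin d)) :
    IsNearestPoint X p (euclideanProj X p) := by
  obtain ⟨q, hq, hmin⟩ := hc.exists_isMinOn hn
    (f := fun z => ‖z - p‖) (by fun_prop)
  exact Classical.epsilon_spec (p := IsNearestPoint X p) ⟨q, hq, fun z hz => hmin hz⟩

/-- The unprojected points of the lazy, anytime Subgradient algorithm with base point `y₁`,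
parameter `η` and cost vectors `b 0, b 1, …` (rounds are counted from `0`). -/
def subgradientPoint {d : ℕ} (y₁ : EuclideanSpace ℝ (Fin d)) (η : ℝ)
    (b : ℕ → EuclideanSpace ℝ (Fin d)) : ℕ → EuclideanSpace ℝ (Fin d)
  | 0 => y₁
  | n + 1 => y₁ - (η / Real.sqrt ((n + 1 : ℕ) : ℝ)) • ∑ i ∈ Finset.range (n + 1), b i

/-- The action chosen in round `n` by the lazy, anytime Subgradient algorithm on `X`. -/
def subgradientAction {d : ℕ} (X : Set (EuclideanSpace ℝ (Fin d)))
    (y₁ : EuclideanSpace ℝ (Fin d)) (η : ℝ)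
    (b : ℕ → EuclideanSpace ℝ (Fin d)) (n : ℕ) : EuclideanSpace ℝ (Fin d) :=
  euclideanProj X (subgradientPoint y₁ η b n)

end

/-! ### Vertices, faces and the suboptimality gap -/

section Geometry

variable {d : ℕ} {P : Set (EuclideanSpace ℝ (Fin d))}

/-! The projection `q` of `y - θ b` minimises the linear function given by the residual `q - (y - θ
b)`. Its face of minimisers contains a vertex `v` with `a · v ≥ a · q`, so a suboptimal `q` forces
`v` to be suboptimal by at least `Δ`. Since `v` still passes the residual test,
`inner_euclideanProj_sub_le` follows: the loss is at most `D² / θ + D ‖b - a‖`, and it is zero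
unless this bound reaches `Δ`.

In round `n`, `b` is the average cost and `θ = η √n`. With `A = 2LD/W` and `B = RD/W` the bound is
`A / √n + X`, where `X` is `D` times the averaging error along `P`. The width turns the bound `R` on
extents into the norm bound `R / W`, so `E X² ≤ B² / n` and `E X⁴ ≤ 3 B⁴ / n²`. Early rounds cost
`(A + B) / √n` on average. Once `A / √n ≤ Δ / 2`, a nonzero loss needs `X ≥ Δ / 2`, and the fourth
moment gives a summable `n⁻²` tail (`integral_le_of_gap`). Cutting at `n ≈ (A + B)² / Δ²` balances
the two (`sum_range_le_of_two_regimes`). Fourth moments suffice; no exponential concentration is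
used. -/

theorem IsPolytope.isCompact (hP : IsPolytope P) : IsCompact P := by
  obtain ⟨V, -, rfl⟩ := hP
  exact V.finite_toSet.isCompact_convexHull ℝ

theorem IsPolytope.convex (hP : IsPolytope P) : Convex ℝ P := by
  obtain ⟨V, -, rfl⟩ := hP
  exact convex_convexHull ℝ _

theorem IsPolytope.nonempty (hP : IsPolytope P) : P.Nonempty := by
  obtain ⟨V, hV, rfl⟩ := hP
  exact convexHull_nonempty_iff.2 hV

theorem IsPolytope.finite_extremePoints (hP : IsPolytope P) : (P.extremePoints ℝ).Finite := by
  obtain ⟨V, -, rfl⟩ := hP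
  exact V.finite_toSet.subset extremePoints_convexHull_subset

theorem IsPolytope.convexHull_extremePoints (hP : IsPolytope P) :
    convexHull ℝ (P.extremePoints ℝ) = P := by
  rw [← (hP.finite_extremePoints.isClosed_convexHull ℝ).closure_eq]
  exact closure_convexHull_extremePoints hP.isCompact hP.convex

/-- The face of minimisers of `c` through `x` has a vertex at which `a` is at least as large as
it is at `x`. -/
theorem IsLinearMinimizer.exists_extremePoint_ge {c x : EuclideanSpace ℝ (Fin d)}
    (hP : IsPolytope P) (hx : IsLinearMinimizer P c x) (a : EuclideanSpace ℝ (Fin d)) :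
    ∃ v ∈ P.extremePoints ℝ, (inner ℝ c v : ℝ) = inner ℝ c x ∧
      (inner ℝ a x : ℝ) ≤ inner ℝ a v := by
  by_contra! hcon
  have hxmem : x ∈ convexHull ℝ (hP.finite_extremePoints.toFinset : Set _) := by
    rw [Set.Finite.coe_toFinset, hP.convexHull_extremePoints]
    exact hx.1
  obtain ⟨w, hw0, hw1, hwx⟩ := Finset.mem_convexHull'.1 hxmem
  have hsum : ∀ u : EuclideanSpace ℝ (Fin d),
      ∑ v ∈ hP.finite_extremePoints.toFinset, w v * (inner ℝ u v - inner ℝ u x : ℝ) = 0 := by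
    intro u
    simp only [mul_sub, Finset.sum_sub_distrib, ← Finset.sum_mul, hw1, one_mul]
    conv_lhs => rw [← hwx]
    simp [inner_sum, real_inner_smul_right]
  -- A convex combination of vertices attaining the minimum of `c` puts weight only on minimising
  -- vertices. There `a` would be strictly smaller than at `x`, so all weights would vanish.
  have hc := (Finset.sum_eq_zero_iff_of_nonneg (fun v hv => mul_nonneg (hw0 v hv)
    (sub_nonneg.2 (hx.2 v (extremePoints_subset (by simpa using hv)))))).1 (hsum c)
  have hle : ∀ v ∈ hP.finite_extremePoints.toFinset,
      w v * (inner ℝ a v - inner ℝ a x : ℝ) ≤ 0 ∧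
      (w v * (inner ℝ a v - inner ℝ a x : ℝ) = 0 → w v = 0) := by
    intro v hv
    rcases mul_eq_zero.1 (hc v hv) with h | h
    · simp [h]
    · have := hcon v (by simpa using hv) (sub_eq_zero.1 h)
      refine ⟨mul_nonpos_of_nonneg_of_nonpos (hw0 v hv) (by linarith), fun h' => ?_⟩
      exact (mul_eq_zero.1 h').resolve_right (by linarith)
  have ha := (Finset.sum_eq_zero_iff_of_nonpos (fun v hv => (hle v hv).1)).1 (hsum a)
  rw [Finset.sum_eq_zero fun v hv => (hle v hv).2 (ha v hv)] at hw1
  exact zero_ne_one hw1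

/-- The suboptimality gap is positive, and at most the suboptimality of each suboptimal vertex. -/
theorem suboptimalityGap_pos_and_le {a v xs : EuclideanSpace ℝ (Fin d)} (hP : IsPolytope P)
    (hxs : IsLinearMinimizer P a xs) (hv : v ∈ P.extremePoints ℝ)
    (hpos : (0 : ℝ) < inner ℝ a (v - xs)) :
    0 < suboptimalityGap P a ∧ suboptimalityGap P a ≤ inner ℝ a (v - xs) := by
  obtain ⟨w, hw, hwx, -⟩ := hxs.exists_extremePoint_ge hP a
  have hvw : (inner ℝ a (v - w) : ℝ) = inner ℝ a (v - xs) := by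
    simp [inner_sub_right, hwx]
  have hmem : (inner ℝ a (v - xs) : ℝ) ∈ {g : ℝ | ∃ v ∈ P.extremePoints ℝ,
      ∃ w ∈ P.extremePoints ℝ, IsLinearMinimizer P a w ∧ g = inner ℝ a (v - w) ∧ 0 < g} :=
    ⟨v, hv, w, hw, ⟨extremePoints_subset hw, fun z hz => hwx ▸ hxs.2 z hz⟩, hvw.symm, hpos⟩
  constructor
  -- Finitely many vertex pairs: the infimum is attained and hence positive.
  · have hfin : Set.Finite {g : ℝ | ∃ v ∈ P.extremePoints ℝ,
        ∃ w ∈ P.extremePoints ℝ, IsLinearMinimizer P a w ∧ g = inner ℝ a (v - w) ∧ 0 < g} := by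
      refine (hP.finite_extremePoints.image2 (fun v w => (inner ℝ a (v - w) : ℝ))
        hP.finite_extremePoints).subset ?_
      rintro g ⟨v, hv, w, hw, -, rfl, -⟩
      exact ⟨v, hv, w, hw, rfl⟩
    obtain ⟨_, _, _, _, _, _, h⟩ := Set.Nonempty.csInf_mem ⟨_, hmem⟩ hfin
    exact h
  · refine csInf_le ⟨0, ?_⟩ hmem
    rintro g ⟨_, _, _, _, _, _, h⟩
    exact h.le

/-! ### Euclidean projection -/

theorem IsNearestPoint.inner_nonpos {X : Set (EuclideanSpace ℝ (Fin d))} (hX : Convex ℝ X)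
    {p q z : EuclideanSpace ℝ (Fin d)} (hq : IsNearestPoint X p q) (hz : z ∈ X) :
    (inner ℝ (p - q) (z - q) : ℝ) ≤ 0 := by
  refine (norm_eq_iInf_iff_real_inner_le_zero hX hq.1).1 ?_ z hz
  have : Nonempty X := ⟨⟨q, hq.1⟩⟩
  refine le_antisymm (le_ciInf fun w => ?_) (ciInf_le ⟨0, ?_⟩ (⟨q, hq.1⟩ : X))
  · rw [norm_sub_rev, norm_sub_rev p]
    exact hq.2 w w.2
  · rintro _ ⟨w, rfl⟩
    exact norm_nonneg _

/-- Adding the two variational inequalities shows that the projection is nonexpansive. Continuity is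
needed for measurability of the losses. -/
theorem continuous_euclideanProj {X : Set (EuclideanSpace ℝ (Fin d))} (hc : IsCompact X)
    (hn : X.Nonempty) (hX : Convex ℝ X) : Continuous (euclideanProj X) := by
  refine LipschitzWith.continuous (K := 1) (LipschitzWith.of_dist_le_mul fun p p' => ?_)
  have h := euclideanProj_spec hc hn p
  have h' := euclideanProj_spec hc hn p'
  have h1 := h.inner_nonpos hX h'.1
  have h2 := h'.inner_nonpos hX h.1
  set q := euclideanProj X p
  set q' := euclideanProj X p'
  rw [NNReal.coe_one, one_mul, dist_eq_norm, dist_eq_norm]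
  have key : ‖q - q'‖ ^ 2 ≤ ‖p - p'‖ * ‖q - q'‖ := by
    refine le_trans ?_ (real_inner_le_norm (p - p') (q - q'))
    rw [← real_inner_self_eq_norm_sq]
    simp only [inner_sub_left, inner_sub_right] at h1 h2 ⊢
    linarith
  by_contra! hlt
  nlinarith [norm_nonneg (p - p')]

/-! ### Extents and width -/

theorem inner_le_directionalWidth (hc : IsCompact P) {x y : EuclideanSpace ℝ (Fin d)}
    (l : EuclideanSpace ℝ (Fin d)) (hx : x ∈ P) (hy : y ∈ P) :
    (inner ℝ l (x - y) : ℝ) ≤ directionalWidth P l := by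
  refine le_csSup ⟨‖l‖ * Metric.diam P, ?_⟩ ⟨x, hx, y, hy, rfl⟩
  rintro _ ⟨u, hu, v, hv, rfl⟩
  refine (real_inner_le_norm _ _).trans ?_
  gcongr
  rw [← dist_eq_norm]
  exact Metric.dist_le_diam_of_mem hc.isBounded hu hv

theorem directionalWidth_le (hn : P.Nonempty) {l : EuclideanSpace ℝ (Fin d)} {M : ℝ}
    (h : ∀ x ∈ P, ∀ y ∈ P, (inner ℝ l (x - y) : ℝ) ≤ M) : directionalWidth P l ≤ M := by
  obtain ⟨x, hx⟩ := hn
  refine csSup_le ⟨_, x, hx, x, hx, rfl⟩ ?_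
  rintro _ ⟨u, hu, v, hv, rfl⟩
  exact h u hu v hv

theorem directionalWidth_nonneg (hc : IsCompact P) (hn : P.Nonempty)
    (l : EuclideanSpace ℝ (Fin d)) : 0 ≤ directionalWidth P l := by
  obtain ⟨x, hx⟩ := hn
  simpa using inner_le_directionalWidth hc l hx hx

theorem continuous_directionalWidth (hc : IsCompact P) : Continuous (directionalWidth P) := by
  have := (hc.prod hc).continuous_sSup
    (f := fun (l : EuclideanSpace ℝ (Fin d)) (z : EuclideanSpace ℝ (Fin d) ×
      EuclideanSpace ℝ (Fin d)) => (inner ℝ l (z.1 - z.2) : ℝ)) (by fun_prop)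
  convert this using 2 with l
  unfold directionalWidth
  congr 1
  ext w
  simp [and_assoc, eq_comm]

/-- Zero extent would make `l` orthogonal to the direction space that contains it. -/
theorem directionalWidth_pos (hc : IsCompact P) {l : EuclideanSpace ℝ (Fin d)}
    (hl : l ∈ (affineSpan ℝ P).direction) (hl0 : l ≠ 0) : 0 < directionalWidth P l := by
  by_contra! hle
  refine hl0 ?_
  have horth : vectorSpan ℝ P ≤ (ℝ ∙ l)ᗮ := by
    refine Submodule.span_le.2 ?_
    rintro _ ⟨x, hx, y, hy, rfl⟩
    rw [SetLike.mem_coe, Submodule.mem_orthogonal_singleton_iff_inner_right]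
    change (inner ℝ l (x - y) : ℝ) = 0
    have h1 := (inner_le_directionalWidth hc l hx hy).trans hle
    have h2 := (inner_le_directionalWidth hc l hy hx).trans hle
    rw [← neg_sub, inner_neg_right] at h2
    linarith
  rw [direction_affineSpan] at hl
  exact inner_self_eq_zero.1 (Submodule.mem_orthogonal_singleton_iff_inner_right.1 (horth hl))

theorem exists_unit_mem_direction (hP2 : P.Nontrivial) :
    ∃ l ∈ (affineSpan ℝ P).direction, ‖l‖ = 1 := by
  obtain ⟨x, hx, y, hy, hxy⟩ := hP2
  have h0 : x - y ≠ 0 := sub_ne_zero.2 hxy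
  refine ⟨‖x - y‖⁻¹ • (x - y), Submodule.smul_mem _ _ ?_, by
    rw [norm_smul, norm_inv, norm_norm, inv_mul_cancel₀ (norm_ne_zero_iff.2 h0)]⟩
  rw [direction_affineSpan]
  exact vsub_mem_vectorSpan ℝ hx hy

theorem polytopeWidth_le (hc : IsCompact P) (hn : P.Nonempty) {l : EuclideanSpace ℝ (Fin d)}
    (hl : l ∈ (affineSpan ℝ P).direction) (hl1 : ‖l‖ = 1) :
    polytopeWidth P ≤ directionalWidth P l := by
  refine csInf_le ⟨0, ?_⟩ ⟨l, hl, hl1, rfl⟩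
  rintro _ ⟨m, -, -, rfl⟩
  exact directionalWidth_nonneg hc hn m

/-- The extent is continuous, so it attains its minimum on the compact unit sphere of the direction
space. -/
theorem polytopeWidth_pos (hc : IsCompact P) (hP2 : P.Nontrivial) : 0 < polytopeWidth P := by
  have hK : IsCompact (((affineSpan ℝ P).direction : Set (EuclideanSpace ℝ (Fin d))) ∩
      Metric.sphere 0 1) :=
    (isCompact_sphere _ _).inter_left (Submodule.closed_of_finiteDimensional _)
  obtain ⟨l₀, hl₀, hl₀1⟩ := exists_unit_mem_direction hP2
  obtain ⟨l, ⟨hl, hl1⟩, hmin⟩ := hK.exists_isMinOn ⟨l₀, hl₀, by simpa using hl₀1⟩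
    (continuous_directionalWidth hc).continuousOn
  have hl1' : ‖l‖ = 1 := by simpa using hl1
  refine (directionalWidth_pos hc hl (by rintro rfl; simp at hl1')).trans_le ?_
  refine le_csInf ⟨_, l₀, hl₀, hl₀1, rfl⟩ ?_
  rintro _ ⟨m, hm, hm1, rfl⟩
  exact hmin ⟨hm, by simpa using hm1⟩

theorem polytopeWidth_le_diam (hc : IsCompact P) (hP2 : P.Nontrivial) :
    polytopeWidth P ≤ Metric.diam P := by
  obtain ⟨l, hl, hl1⟩ := exists_unit_mem_direction hP2
  refine (polytopeWidth_le hc hP2.nonempty hl hl1).trans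
    (directionalWidth_le hP2.nonempty fun x hx y hy => ?_)
  refine (real_inner_le_norm _ _).trans ?_
  rw [hl1, one_mul, ← dist_eq_norm]
  exact Metric.dist_le_diam_of_mem hc.isBounded hx hy

theorem inner_starProjection_direction {x y : EuclideanSpace ℝ (Fin d)} (hx : x ∈ P) (hy : y ∈ P)
    (u : EuclideanSpace ℝ (Fin d)) :
    (inner ℝ ((affineSpan ℝ P).direction.starProjection u) (x - y) : ℝ) = inner ℝ u (x - y) := by
  rw [Submodule.inner_starProjection_left_eq_right, Submodule.starProjection_eq_self_iff.2]
  rw [direction_affineSpan]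
  exact vsub_mem_vectorSpan ℝ hx hy

/-- The width is tested in the direction of the projected vector. Components normal to the affine
hull are invisible to differences of points of `P`. -/
theorem norm_starProjection_mul_polytopeWidth_le (hc : IsCompact P) (hn : P.Nonempty)
    {u : EuclideanSpace ℝ (Fin d)} {M : ℝ}
    (h : ∀ x ∈ P, ∀ y ∈ P, (inner ℝ u (x - y) : ℝ) ≤ M) :
    ‖(affineSpan ℝ P).direction.starProjection u‖ * polytopeWidth P ≤ M := by
  set p := (affineSpan ℝ P).direction.starProjection u with hp
  have hM : 0 ≤ M := by
    obtain ⟨x, hx⟩ := hn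
    simpa using h x hx x hx
  rcases eq_or_ne p 0 with h0 | h0
  · simpa [h0] using hM
  have hpos : 0 < ‖p‖ := norm_pos_iff.2 h0
  have hw := polytopeWidth_le hc hn (l := ‖p‖⁻¹ • p)
    (Submodule.smul_mem _ _ (Submodule.starProjection_apply_mem _ _))
    (by rw [norm_smul, norm_inv, norm_norm, inv_mul_cancel₀ hpos.ne'])
  have hd : directionalWidth P (‖p‖⁻¹ • p) ≤ ‖p‖⁻¹ * M := by
    refine directionalWidth_le hn fun x hx y hy => ?_
    rw [real_inner_smul_left, hp, inner_starProjection_direction hx hy]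
    exact mul_le_mul_of_nonneg_left (h x hx y hy) (by positivity)
  calc ‖p‖ * polytopeWidth P ≤ ‖p‖ * (‖p‖⁻¹ * M) := by gcongr; exact hw.trans hd
    _ = M := by field_simp

/-- If the projection of `y - θ b` is compared with a point `z` at which `b`, tilted by the
projection residual, is at least as small, then the loss under `a` is controlled by the distance
of `a` and `b` along `P`. -/
theorem inner_le_of_nearestPoint_face (hc : IsCompact P)
    {a b y q v z : EuclideanSpace ℝ (Fin d)} {θ : ℝ} (hθ : 0 < θ) (hy : y ∈ P) (hq : q ∈ P)
    (hv : v ∈ P) (hz : z ∈ P)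
    (h : (inner ℝ (q - (y - θ • b)) v : ℝ) ≤ inner ℝ (q - (y - θ • b)) z) :
    (inner ℝ a (v - z) : ℝ) ≤ Metric.diam P ^ 2 / θ +
      Metric.diam P * ‖(affineSpan ℝ P).direction.starProjection (b - a)‖ := by
  have hdist : ∀ u ∈ P, ∀ w ∈ P, ‖u - w‖ ≤ Metric.diam P := fun u hu w hw => by
    rw [← dist_eq_norm]
    exact Metric.dist_le_diam_of_mem hc.isBounded hu hw
  -- The residual is `(q - y) + θ b`; as `y ∈ P`, its first part contributes at most `D²`.
  have h1 : (inner ℝ (q - y) (z - v) : ℝ) ≤ Metric.diam P ^ 2 := by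
    refine (real_inner_le_norm _ _).trans ?_
    rw [sq]
    exact mul_le_mul (hdist _ hq _ hy) (hdist _ hz _ hv) (norm_nonneg _) Metric.diam_nonneg
  have h2 : (inner ℝ (b - a) (z - v) : ℝ) ≤
      Metric.diam P * ‖(affineSpan ℝ P).direction.starProjection (b - a)‖ := by
    rw [← inner_starProjection_direction hz hv, mul_comm]
    exact (real_inner_le_norm _ _).trans (by gcongr; exact hdist _ hz _ hv)
  have h3 : (inner ℝ b (v - z) : ℝ) ≤ Metric.diam P ^ 2 / θ := by
    rw [le_div_iff₀ hθ]
    refine le_trans ?_ h1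
    simp only [inner_sub_left, inner_sub_right, real_inner_smul_left] at h ⊢
    linarith
  simp only [inner_sub_left, inner_sub_right] at h2 h3 ⊢
  linarith

/-- The loss of the projection of `y - θ b`, and the suboptimality gap if that loss is positive,
are at most `D² / θ + D ‖b - a‖`, where the norm is taken along `P`. -/
theorem inner_euclideanProj_sub_le (hP : IsPolytope P) {a b y xs : EuclideanSpace ℝ (Fin d)}
    {θ : ℝ} (hθ : 0 < θ) (hy : y ∈ P) (hxs : IsLinearMinimizer P a xs) :
    (inner ℝ a (euclideanProj P (y - θ • b) - xs) : ℝ) ≤ Metric.diam P ^ 2 / θ +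
      Metric.diam P * ‖(affineSpan ℝ P).direction.starProjection (b - a)‖ ∧
    ((inner ℝ a (euclideanProj P (y - θ • b) - xs) : ℝ) = 0 ∨
      suboptimalityGap P a ≤ Metric.diam P ^ 2 / θ +
        Metric.diam P * ‖(affineSpan ℝ P).direction.starProjection (b - a)‖) := by
  have hq := euclideanProj_spec hP.isCompact hP.nonempty (y - θ • b)
  set q := euclideanProj P (y - θ • b)
  have hmin : IsLinearMinimizer P (q - (y - θ • b)) q := by
    refine ⟨hq.1, fun z hz => ?_⟩
    have := hq.inner_nonpos hP.convex hz
    rw [← neg_sub, inner_neg_left, inner_sub_right] at this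
    linarith
  refine ⟨inner_le_of_nearestPoint_face hP.isCompact hθ hy hq.1 hq.1 hxs.1 (hmin.2 _ hxs.1), ?_⟩
  rcases (sub_nonneg.2 (hxs.2 q hq.1)).eq_or_lt with h0 | hpos
  · left
    rw [inner_sub_right, ← h0]
  · right
    obtain ⟨v, hv, hvq, hav⟩ := hmin.exists_extremePoint_ge hP a
    refine (suboptimalityGap_pos_and_le hP hxs hv (by rw [inner_sub_right]; linarith)).2.trans ?_
    exact inner_le_of_nearestPoint_face hP.isCompact hθ hy hq.1 (extremePoints_subset hv) hxs.1
      (hvq ▸ hmin.2 _ hxs.1)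

/-- If the suboptimality gap vanishes, every point is optimal; otherwise it is positive and at
most the range of the linear function. -/
theorem suboptimalityGap_cases (hP : IsPolytope P) {a xs : EuclideanSpace ℝ (Fin d)}
    (hxs : IsLinearMinimizer P a xs) {M : ℝ}
    (h : ∀ x ∈ P, ∀ y ∈ P, (inner ℝ a (x - y) : ℝ) ≤ M) :
    (suboptimalityGap P a = 0 ∧ ∀ z ∈ P, (inner ℝ a (z - xs) : ℝ) = 0) ∨
      (0 < suboptimalityGap P a ∧ suboptimalityGap P a ≤ M) := by
  by_cases hex : ∃ v ∈ P.extremePoints ℝ, (0 : ℝ) < inner ℝ a (v - xs)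
  · obtain ⟨v, hv, hpos⟩ := hex
    have := suboptimalityGap_pos_and_le hP hxs hv hpos
    exact Or.inr ⟨this.1, this.2.trans (h v (extremePoints_subset hv) xs hxs.1)⟩
  · push Not at hex
    left
    constructor
    · unfold suboptimalityGap
      convert Real.sInf_empty
      refine Set.eq_empty_of_forall_notMem ?_
      rintro g ⟨v, hv, w, hw, hwmin, rfl, hpos⟩
      have h1 := hex v hv
      have h2 := hxs.2 w (extremePoints_subset hw)
      rw [inner_sub_right] at h1 hpos
      linarith
    · intro z hz
      -- With `c = 0` the face of minimisers is all of `P`.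
      obtain ⟨v, hv, -, hzv⟩ := IsLinearMinimizer.exists_extremePoint_ge hP (c := 0) (x := z)
        ⟨hz, by simp⟩ a
      have h1 := hex v hv
      have h2 := hxs.2 z hz
      rw [inner_sub_right] at h1 ⊢
      linarith

end Geometry

/-! ### Moments of sums of independent centred vectors -/

section Moments

variable {Ω : Type*} [MeasurableSpace Ω] {μ : Measure Ω}

theorem ae_norm_sum_range_le {E : Type*} [SeminormedAddCommGroup E] {D : ℕ → Ω → E} {ρ : ℝ}
    (hb : ∀ n, ∀ᵐ ω ∂μ, ‖D n ω‖ ≤ ρ) (n : ℕ) :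
    ∀ᵐ ω ∂μ, ‖∑ i ∈ Finset.range n, D i ω‖ ≤ n * ρ := by
  filter_upwards [ae_all_iff.2 hb] with ω hω
  refine (norm_sum_le_of_le _ fun i _ => hω i).trans ?_
  simp

variable {E : Type*} [NormedAddCommGroup E] [InnerProductSpace ℝ E]

/-- Square `‖s‖² + 2⟨s, x⟩ + ‖x‖²` and apply Cauchy-Schwarz to `⟨s, x⟩²`. The two odd terms stay
exact, in product form, so that independence can remove them in expectation. -/
theorem norm_add_pow_four_le {s x : E} {ρ : ℝ} (hx : ‖x‖ ≤ ρ) :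
    ‖s + x‖ ^ 4 ≤ ‖s‖ ^ 4 + 6 * ρ ^ 2 * ‖s‖ ^ 2 + ρ ^ 4 +
      4 * inner ℝ (‖s‖ ^ 2 • s) x + 4 * inner ℝ s (‖x‖ ^ 2 • x) := by
  have h1 : ‖s + x‖ ^ 4 = (‖s‖ ^ 2 + 2 * inner ℝ s x + ‖x‖ ^ 2) ^ 2 := by
    rw [← norm_add_sq_real]; ring
  have h2 : (inner ℝ s x : ℝ) ^ 2 ≤ ‖s‖ ^ 2 * ‖x‖ ^ 2 := by
    rw [← mul_pow]
    exact sq_le_sq' (neg_le_of_abs_le (abs_real_inner_le_norm s x)) (real_inner_le_norm s x)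
  have h3 : ‖x‖ ^ 2 ≤ ρ ^ 2 := by gcongr
  have h4 : ‖x‖ ^ 4 ≤ ρ ^ 4 := by gcongr
  have h5 : ‖s‖ ^ 2 * ‖x‖ ^ 2 ≤ ‖s‖ ^ 2 * ρ ^ 2 := by gcongr
  rw [h1, real_inner_smul_left, real_inner_smul_right]
  nlinarith

variable [MeasurableSpace E] [BorelSpace E]

theorem ProbabilityTheory.IndepFun.integrable_inner {X Y : Ω → E}
    (h : IndepFun X Y μ) (hX : Integrable X μ) (hY : Integrable Y μ) :
    Integrable (fun ω => (inner ℝ (X ω) (Y ω) : ℝ)) μ :=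
  h.integrable_bilin hX hY (innerSL ℝ)

variable [CompleteSpace E]

theorem ProbabilityTheory.IndepFun.integral_inner_eq_inner_integral {X Y : Ω → E}
    (h : IndepFun X Y μ) (hX : Integrable X μ) (hY : Integrable Y μ) :
    ∫ ω, (inner ℝ (X ω) (Y ω) : ℝ) ∂μ = inner ℝ (∫ ω, X ω ∂μ) (∫ ω, Y ω ∂μ) :=
  h.integral_bilin hX hY (innerSL ℝ)

/-- Second and fourth moment bounds for a sum of independent bounded centred random vectors. -/
theorem integral_norm_sum_range_pow_le [IsProbabilityMeasure μ] [SecondCountableTopology E]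
    {D : ℕ → Ω → E} {ρ : ℝ} (hm : ∀ n, AEMeasurable (D n) μ) (hi : iIndepFun D μ)
    (hb : ∀ n, ∀ᵐ ω ∂μ, ‖D n ω‖ ≤ ρ) (h0 : ∀ n, ∫ ω, D n ω ∂μ = 0) (n : ℕ) :
    ∫ ω, ‖∑ i ∈ Finset.range n, D i ω‖ ^ 2 ∂μ ≤ n * ρ ^ 2 ∧
    ∫ ω, ‖∑ i ∈ Finset.range n, D i ω‖ ^ 4 ∂μ ≤ 3 * n ^ 2 * ρ ^ 4 := by
  have hint : ∀ {X : Ω → E} {C : ℝ} (f : E → E), Continuous f → AEMeasurable X μ →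
      (∀ᵐ ω ∂μ, ‖f (X ω)‖ ≤ C) → Integrable (fun ω => f (X ω)) μ := fun f hf hX hC =>
    Integrable.of_bound (hf.comp_aestronglyMeasurable hX.aestronglyMeasurable) _ hC
  induction n with
  | zero => simp
  | succ n ih =>
    obtain ⟨ih2, ih4⟩ := ih
    set S : Ω → E := fun ω => ∑ i ∈ Finset.range n, D i ω with hS
    have hSm : AEMeasurable S μ := Finset.aemeasurable_fun_sum _ fun i _ => hm i
    have hSb : ∀ᵐ ω ∂μ, ‖S ω‖ ≤ n * ρ := ae_norm_sum_range_le hb n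
    have hind : IndepFun S (D n) μ := by
      have := hi.indepFun_finsetSum_of_notMem₀ hm (s := Finset.range n) (i := n) (by simp)
      convert this using 1
      ext ω
      simp [hS]
    have hSpow : ∀ k : ℕ, Integrable (fun ω => ‖S ω‖ ^ k) μ := fun k => by
      refine Integrable.of_bound (hSm.norm.pow_const k).aestronglyMeasurable ((n * ρ) ^ k) ?_
      filter_upwards [hSb] with ω hω
      rw [norm_pow, norm_norm]
      gcongr
    have hSi : Integrable S μ := hint id continuous_id hSm hSb
    have hDi : Integrable (D n) μ := hint id continuous_id (hm n) (hb n)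
    have hcube : Continuous fun x : E => ‖x‖ ^ 2 • x := by fun_prop
    have hcubeb : ∀ {x : E} {C : ℝ}, ‖x‖ ≤ C → ‖‖x‖ ^ 2 • x‖ ≤ C ^ 2 * C := fun {x C} hx => by
      rw [norm_smul, norm_pow, norm_norm]
      gcongr
    have hS3i : Integrable (fun ω => ‖S ω‖ ^ 2 • S ω) μ :=
      hint _ hcube hSm (hSb.mono fun ω => hcubeb)
    have hD3i : Integrable (fun ω => ‖D n ω‖ ^ 2 • D n ω) μ :=
      hint _ hcube (hm n) ((hb n).mono fun ω => hcubeb)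
    have hS0 : ∫ ω, S ω ∂μ = 0 := by
      simp only [hS]
      rw [integral_finsetSum (f := D) _ fun i _ => hint id continuous_id (hm i) (hb i)]
      simp [h0]
    have hindL : IndepFun (fun ω => ‖S ω‖ ^ 2 • S ω) (D n) μ :=
      hind.comp hcube.measurable measurable_id
    have hindR : IndepFun S (fun ω => ‖D n ω‖ ^ 2 • D n ω) μ :=
      hind.comp measurable_id hcube.measurable
    have e1 : ∫ ω, (inner ℝ (S ω) (D n ω) : ℝ) ∂μ = 0 := by
      rw [hind.integral_inner_eq_inner_integral hSi hDi, h0, inner_zero_right]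
    have e2 : ∫ ω, (inner ℝ (‖S ω‖ ^ 2 • S ω) (D n ω) : ℝ) ∂μ = 0 := by
      rw [hindL.integral_inner_eq_inner_integral hS3i hDi, h0, inner_zero_right]
    -- The cubed increment need not be centred; here the mean of `S` vanishes instead.
    have e3 : ∫ ω, (inner ℝ (S ω) (‖D n ω‖ ^ 2 • D n ω) : ℝ) ∂μ = 0 := by
      rw [hindR.integral_inner_eq_inner_integral hSi hD3i, hS0, inner_zero_left]
    have i1 := hind.integrable_inner hSi hDi
    have i2 := hindL.integrable_inner hS3i hDi
    have i3 := hindR.integrable_inner hSi hD3i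
    have hS2 := hSpow 2
    have hS4 := hSpow 4
    simp only [Finset.sum_range_succ]
    constructor
    · calc ∫ ω, ‖S ω + D n ω‖ ^ 2 ∂μ
          ≤ ∫ ω, (‖S ω‖ ^ 2 + ρ ^ 2 + 2 * inner ℝ (S ω) (D n ω)) ∂μ := by
            refine integral_mono_of_nonneg (Filter.Eventually.of_forall fun ω => by positivity)
              (((hSpow 2).add (integrable_const _)).add (i1.const_mul 2)) ?_
            filter_upwards [hb n] with ω hω
            have : ‖D n ω‖ ^ 2 ≤ ρ ^ 2 := by gcongr
            change ‖S ω + D n ω‖ ^ 2 ≤ _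
            rw [norm_add_sq_real]
            linarith
        _ = ∫ ω, ‖S ω‖ ^ 2 ∂μ + ρ ^ 2 := by
            rw [integral_add (by fun_prop) (by fun_prop), integral_add (by fun_prop) (by fun_prop),
              integral_const_mul, e1]
            simp
        _ ≤ ((n + 1 : ℕ) : ℝ) * ρ ^ 2 := by
            push_cast
            linarith
    · calc ∫ ω, ‖S ω + D n ω‖ ^ 4 ∂μ
          ≤ ∫ ω, (‖S ω‖ ^ 4 + 6 * ρ ^ 2 * ‖S ω‖ ^ 2 + ρ ^ 4 +
              4 * inner ℝ (‖S ω‖ ^ 2 • S ω) (D n ω) +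
              4 * inner ℝ (S ω) (‖D n ω‖ ^ 2 • D n ω)) ∂μ := by
            refine integral_mono_of_nonneg (Filter.Eventually.of_forall fun ω => by positivity)
              (((((hSpow 4).add ((hSpow 2).const_mul _)).add (integrable_const _)).add
                (i2.const_mul 4)).add (i3.const_mul 4)) ?_
            filter_upwards [hb n] with ω hω
            exact norm_add_pow_four_le hω
        _ = ∫ ω, ‖S ω‖ ^ 4 ∂μ + 6 * ρ ^ 2 * ∫ ω, ‖S ω‖ ^ 2 ∂μ + ρ ^ 4 := by
            rw [integral_add (by fun_prop) (by fun_prop), integral_add (by fun_prop) (by fun_prop),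
              integral_add (by fun_prop) (by fun_prop), integral_add (by fun_prop) (by fun_prop),
              integral_const_mul, integral_const_mul, integral_const_mul, e2, e3]
            simp
        -- The induction closes because `3n² + 6n + 1 ≤ 3(n + 1)²`.
        _ ≤ 3 * ((n + 1 : ℕ) : ℝ) ^ 2 * ρ ^ 4 := by
            push_cast
            have := mul_le_mul_of_nonneg_left ih2 (by positivity : 0 ≤ 6 * ρ ^ 2)
            nlinarith [sq_nonneg (ρ ^ 2)]

end Moments

/-! ### Summing the losses -/

section Series

theorem inv_sqrt_succ_le (m : ℕ) :
    1 / √((m + 1 : ℕ) : ℝ) ≤ 2 * (√((m + 1 : ℕ) : ℝ) - √(m : ℝ)) := by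
  have hs := Real.sq_sqrt (Nat.cast_nonneg (α := ℝ) m)
  have ht := Real.sq_sqrt (Nat.cast_nonneg (α := ℝ) (m + 1))
  have htpos : 0 < √((m + 1 : ℕ) : ℝ) := Real.sqrt_pos.2 (by positivity)
  rw [div_le_iff₀ htpos]
  push_cast at *
  nlinarith [sq_nonneg (√((m : ℝ) + 1) - √(m : ℝ))]

theorem inv_sq_succ_le {m : ℕ} (hm : 0 < m) :
    1 / ((m + 1 : ℕ) : ℝ) ^ 2 ≤ 1 / (m : ℝ) - 1 / ((m + 1 : ℕ) : ℝ) := by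
  have hm' : (0 : ℝ) < m := by exact_mod_cast hm
  rw [div_sub_div _ _ (by positivity) (by positivity), div_le_div_iff₀ (by positivity)
    (by positivity)]
  push_cast
  nlinarith

/-- A sequence that decays like `n ^ (-1 / 2)` up to a threshold, and like `n ^ (-2)` beyond it,
has bounded partial sums. -/
theorem sum_range_le_of_two_regimes {A B Δ : ℝ} (hΔ : 0 < Δ) (hΔA : Δ ≤ A / 2) (hB : 0 ≤ B)
    {e : ℕ → ℝ} (he0 : e 0 ≤ A / 2) (hpos : ∀ n, 0 ≤ e n)
    (h1 : ∀ n : ℕ, 0 < n → e n ≤ (A + B) * (1 / √(n : ℝ)))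
    (h2 : ∀ n : ℕ, 0 < n → A / √(n : ℝ) ≤ Δ / 2 →
      e n ≤ 48 * B ^ 4 / Δ ^ 3 * (1 / (n : ℝ) ^ 2)) (m : ℕ) :
    ∑ n ∈ Finset.range m, e n ≤ (25 / 4 * A ^ 2 + 12 * (A * B) + 23 / 2 * B ^ 2) / Δ := by
  have hA : 0 < A := by linarith
  -- Beyond `T` one has `A / √n ≤ Δ / 3`, so the second regime applies, while `2(A + B)√T = 6(A +
  -- B)² / Δ`.
  set T : ℝ := 9 * (A + B) ^ 2 / Δ ^ 2 with hT
  set N := ⌊T⌋₊ with hN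
  have hTsq : √T = 3 * (A + B) / Δ := by
    rw [hT, show 9 * (A + B) ^ 2 / Δ ^ 2 = (3 * (A + B) / Δ) ^ 2 by ring]
    exact Real.sqrt_sq (by positivity)
  have hT36 : 36 ≤ T := by
    rw [hT, le_div_iff₀ (by positivity)]
    nlinarith
  have hTN : T < N + 1 := Nat.lt_floor_add_one T
  have hNT : (N : ℝ) ≤ T := Nat.floor_le (by linarith)
  have hNpos : 0 < N := by
    have : (0 : ℝ) < N := by linarith
    exact_mod_cast this
  have hsmall : ∀ k, k ≤ N → ∑ n ∈ Finset.range (k + 1), e n ≤ A / 2 + 2 * (A + B) * √(k : ℝ) := by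
    intro k
    induction k with
    | zero => simpa using he0
    | succ k ih =>
      intro hk
      rw [Finset.sum_range_succ]
      have i1 := ih (by omega)
      have i2 := h1 (k + 1) (by omega)
      have i3 := mul_le_mul_of_nonneg_left (inv_sqrt_succ_le k) (by positivity : 0 ≤ A + B)
      linarith
  have hlarge : ∀ k, N ≤ k → ∑ n ∈ Finset.range (k + 1), e n ≤
      A / 2 + 2 * (A + B) * √(N : ℝ) + 48 * B ^ 4 / Δ ^ 3 * (1 / (N : ℝ) - 1 / (k : ℝ)) := by
    intro k hk
    induction k, hk using Nat.le_induction with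
    | base => simpa using hsmall N le_rfl
    | succ k hk ih =>
      rw [Finset.sum_range_succ]
      have hTk : T ≤ ((k + 1 : ℕ) : ℝ) := by
        have : (N : ℝ) ≤ k := by exact_mod_cast hk
        push_cast
        linarith
      have hsq : A / √((k + 1 : ℕ) : ℝ) ≤ Δ / 2 := by
        have : 3 * (A + B) / Δ ≤ √((k + 1 : ℕ) : ℝ) := hTsq ▸ Real.sqrt_le_sqrt hTk
        rw [div_le_iff₀ hΔ] at this
        rw [div_le_iff₀ (Real.sqrt_pos.2 (by positivity))]
        linarith
      have i2 := h2 (k + 1) (by omega) hsq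
      have i3 := mul_le_mul_of_nonneg_left (inv_sq_succ_le (m := k) (by omega))
        (by positivity : 0 ≤ 48 * B ^ 4 / Δ ^ 3)
      linarith
  have hfinal : A / 2 + 2 * (A + B) * √(N : ℝ) + 48 * B ^ 4 / Δ ^ 3 * (1 / (N : ℝ)) ≤
      (25 / 4 * A ^ 2 + 12 * (A * B) + 23 / 2 * B ^ 2) / Δ := by
    have j1 : A / 2 ≤ A ^ 2 / 4 / Δ := by
      rw [le_div_iff₀ hΔ]
      nlinarith
    have j2 : 2 * (A + B) * √(N : ℝ) ≤ 6 * (A + B) ^ 2 / Δ := by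
      calc 2 * (A + B) * √(N : ℝ) ≤ 2 * (A + B) * (3 * (A + B) / Δ) := by
            gcongr
            exact hTsq ▸ Real.sqrt_le_sqrt hNT
        _ = 6 * (A + B) ^ 2 / Δ := by ring
    -- `N > T - 1 ≥ 35T / 36`, as `T ≥ 36`.
    have j3 : 1 / (N : ℝ) ≤ 36 / 35 / T := by
      rw [div_le_div_iff₀ (by linarith) (by linarith)]
      linarith
    have j4 : 48 * B ^ 4 / Δ ^ 3 * (1 / (N : ℝ)) ≤ 11 / 2 * B ^ 2 / Δ := by
      calc 48 * B ^ 4 / Δ ^ 3 * (1 / (N : ℝ)) ≤ 48 * B ^ 4 / Δ ^ 3 * (36 / 35 / T) := by gcongr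
        _ = 192 / 35 * B ^ 2 * (B ^ 2 / (A + B) ^ 2) / Δ := by
            rw [hT]
            field_simp
            ring
        _ ≤ 192 / 35 * B ^ 2 * 1 / Δ := by
            gcongr
            rw [div_le_one (by positivity)]
            gcongr
            linarith
        _ ≤ 11 / 2 * B ^ 2 / Δ := by
            rw [mul_one]
            gcongr ?_ * _ / _
            norm_num
    calc _ ≤ A ^ 2 / 4 / Δ + 6 * (A + B) ^ 2 / Δ + 11 / 2 * B ^ 2 / Δ := by linarith
      _ = _ := by ring
  -- Nonnegative terms allow the range to be enlarged past `N`, where `hlarge` applies.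
  refine (Finset.sum_le_sum_of_subset_of_nonneg (Finset.range_mono
    (show m ≤ max m N + 1 by omega)) fun n _ _ => hpos n).trans
    ((hlarge (max m N) (le_max_right _ _)).trans (le_trans ?_ hfinal))
  rw [mul_sub]
  have : 0 ≤ 48 * B ^ 4 / Δ ^ 3 * (1 / ((max m N : ℕ) : ℝ)) := by positivity
  linarith

variable {Ω : Type*} [MeasurableSpace Ω] {μ : Measure Ω}

/-- A series of nonnegative random variables whose expectations have partial sums at most `C`
converges almost surely, to an integrable limit with expectation at most `C`. -/
theorem integral_tsum_le_of_sum_range_le {r : ℕ → Ω → ℝ} (hr0 : ∀ n ω, 0 ≤ r n ω)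
    (hri : ∀ n, Integrable (r n) μ) {C : ℝ}
    (hC : ∀ m, ∑ n ∈ Finset.range m, ∫ ω, r n ω ∂μ ≤ C) :
    (∀ᵐ ω ∂μ, Summable fun n => r n ω) ∧ Integrable (fun ω => ∑' n, r n ω) μ ∧
      ∫ ω, ∑' n, r n ω ∂μ ≤ C := by
  have hi0 : ∀ n, 0 ≤ ∫ ω, r n ω ∂μ := fun n => integral_nonneg (hr0 n)
  have hsum : Summable fun n => ∫ ω, r n ω ∂μ := summable_of_sum_range_le hi0 hC
  have hmeas : ∀ n, AEMeasurable (fun ω => ENNReal.ofReal (r n ω)) μ := fun n =>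
    (hri n).aemeasurable.ennreal_ofReal
  have hfin : ∫⁻ ω, ∑' n, ENNReal.ofReal (r n ω) ∂μ ≠ ⊤ := by
    rw [lintegral_tsum hmeas]
    simp_rw [← ofReal_integral_eq_lintegral_ofReal (hri _) (Filter.Eventually.of_forall (hr0 _))]
    exact hsum.tsum_ofReal_ne_top
  refine ⟨?_, ?_, ?_⟩
  · filter_upwards [ae_lt_top' (AEMeasurable.tsum hmeas) hfin] with ω hω
    convert ENNReal.summable_toReal hω.ne using 2 with n
    exact (ENNReal.toReal_ofReal (hr0 n ω)).symm
  · convert integrable_toReal_of_lintegral_ne_top (AEMeasurable.tsum hmeas) hfin using 2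
      with ω
    rw [ENNReal.tsum_toReal_eq fun n => ENNReal.ofReal_ne_top]
    exact tsum_congr fun n => (ENNReal.toReal_ofReal (hr0 n ω)).symm
  · have hnorm : Summable fun n => ∫ ω, ‖r n ω‖ ∂μ := by
      simpa only [Real.norm_of_nonneg (hr0 _ _)] using hsum
    rw [← (hasSum_integral_of_summable_integral_norm hri hnorm).tsum_eq]
    exact Real.tsum_le_of_sum_range_le hi0 hC

theorem sq_integral_le_integral_sq [IsProbabilityMeasure μ] {X : Ω → ℝ} (h1 : Integrable X μ)
    (h2 : Integrable (fun ω => X ω ^ 2) μ) : (∫ ω, X ω ∂μ) ^ 2 ≤ ∫ ω, X ω ^ 2 ∂μ := by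
  have h : 0 ≤ ∫ ω, (X ω - ∫ ω, X ω ∂μ) ^ 2 ∂μ := integral_nonneg fun ω => sq_nonneg _
  have e : ∫ ω, (X ω - ∫ ω, X ω ∂μ) ^ 2 ∂μ =
      ∫ ω, (X ω ^ 2 - 2 * (∫ ω, X ω ∂μ) * X ω + (∫ ω, X ω ∂μ) ^ 2) ∂μ := by
    congr 1
    ext ω
    ring
  rw [e, integral_add (by fun_prop) (by fun_prop), integral_sub (by fun_prop) (by fun_prop),
    integral_const_mul] at h
  simp only [integral_const, probReal_univ, one_smul] at h
  linarith

/-- A loss bounded by `α + X`, which vanishes unless `α + X` reaches the gap `Δ`, has expectation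
controlled by the moments of `X`. -/
theorem integral_le_of_gap [IsProbabilityMeasure μ] {r X : Ω → ℝ} {α Δ b c : ℝ}
    (hr : ∀ ω, 0 ≤ r ω) (hrX : ∀ ω, r ω ≤ α + X ω) (hgap : ∀ ω, r ω = 0 ∨ Δ ≤ α + X ω)
    (hΔ : 0 < Δ) (hX0 : ∀ ω, 0 ≤ X ω) (hX : ∀ k : ℕ, Integrable (fun ω => X ω ^ k) μ)
    (hb : 0 ≤ b) (h2 : ∫ ω, X ω ^ 2 ∂μ ≤ b ^ 2) (h4 : ∫ ω, X ω ^ 4 ∂μ ≤ c) :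
    ∫ ω, r ω ∂μ ≤ α + b ∧ (α ≤ Δ / 2 → ∫ ω, r ω ∂μ ≤ 16 / Δ ^ 3 * c) := by
  have hX1 : Integrable X μ := by simpa using hX 1
  constructor
  · calc ∫ ω, r ω ∂μ ≤ ∫ ω, (α + X ω) ∂μ :=
          integral_mono_of_nonneg (Filter.Eventually.of_forall hr)
            ((integrable_const _).add hX1) (Filter.Eventually.of_forall hrX)
      _ = α + ∫ ω, X ω ∂μ := by rw [integral_add (by fun_prop) hX1]; simp
      _ ≤ α + b := by
          gcongr
          exact abs_le_of_sq_le_sq' ((sq_integral_le_integral_sq hX1 (hX 2)).trans h2) hb |>.2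
  · intro hα
    calc ∫ ω, r ω ∂μ ≤ ∫ ω, 16 / Δ ^ 3 * X ω ^ 4 ∂μ := by
          refine integral_mono_of_nonneg (Filter.Eventually.of_forall hr)
            ((hX 4).const_mul _) (Filter.Eventually.of_forall fun ω => ?_)
          change r ω ≤ 16 / Δ ^ 3 * X ω ^ 4
          rcases hgap ω with h | h
          · rw [h]
            positivity
          · have hXΔ : Δ / 2 ≤ X ω := by linarith
            have h3 : (Δ / 2) ^ 3 ≤ X ω ^ 3 := by gcongr
            have hmul := mul_le_mul_of_nonneg_right h3 (hX0 ω)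
            rw [div_mul_eq_mul_div, le_div_iff₀ (by positivity)]
            have hr2 : r ω ≤ 2 * X ω := by linarith [hrX ω]
            have := mul_le_mul_of_nonneg_right hr2 (by positivity : 0 ≤ Δ ^ 3)
            nlinarith
      _ ≤ 16 / Δ ^ 3 * c := by
          rw [integral_const_mul]
          gcongr

end Series

/-! ### Application to the algorithm -/

section Regret

variable {d : ℕ} {Ω : Type*} [MeasurableSpace Ω] {μ : Measure Ω}
  {P : Set (EuclideanSpace ℝ (Fin d))}

theorem continuous_subgradientPoint (y : EuclideanSpace ℝ (Fin d)) (η : ℝ) (n : ℕ) :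
    Continuous fun b : ℕ → EuclideanSpace ℝ (Fin d) => subgradientPoint y η b n := by
  cases n with
  | zero => exact continuous_const
  | succ n =>
    change Continuous fun b : ℕ → EuclideanSpace ℝ (Fin d) =>
      y - (η / Real.sqrt ((n + 1 : ℕ) : ℝ)) • ∑ i ∈ Finset.range (n + 1), b i
    fun_prop

theorem subgradientPoint_eq_sub_smul_average (y : EuclideanSpace ℝ (Fin d)) (η : ℝ)
    (b : ℕ → EuclideanSpace ℝ (Fin d)) {n : ℕ} (hn : 0 < n) :
    subgradientPoint y η b n =
      y - (η * √(n : ℝ)) • ((n : ℝ)⁻¹ • ∑ i ∈ Finset.range n, b i) := by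
  obtain ⟨n, rfl⟩ := Nat.exists_eq_add_of_lt hn
  simp only [zero_add]
  change y - (η / √((n + 1 : ℕ) : ℝ)) • ∑ i ∈ Finset.range (n + 1), b i = _
  rw [smul_smul]
  congr 2
  have h := Real.mul_self_sqrt (Nat.cast_nonneg (α := ℝ) (n + 1))
  have h0 : 0 < √((n + 1 : ℕ) : ℝ) := Real.sqrt_pos.2 (by positivity)
  nth_rewrite 3 [← h]
  field_simp

theorem subgradientAction_mem (hP : IsPolytope P) (y : EuclideanSpace ℝ (Fin d)) (η : ℝ)
    (b : ℕ → EuclideanSpace ℝ (Fin d)) (n : ℕ) : subgradientAction P y η b n ∈ P :=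
  (euclideanProj_spec hP.isCompact hP.nonempty _).1

/-- The loss of the `n`-th action, for `n ≥ 1`, in terms of the deviation of the sum of the first
`n` cost vectors along `P`. -/
theorem inner_subgradientAction_sub_le (hP : IsPolytope P) (hP2 : P.Nontrivial)
    {a y xs : EuclideanSpace ℝ (Fin d)} (b : ℕ → EuclideanSpace ℝ (Fin d)) {L : ℝ} (hL : 0 < L)
    (hy : y ∈ P) (hxs : IsLinearMinimizer P a xs) {n : ℕ} (hn : 0 < n) {s : ℝ}
    (hs : s = 2 * L * Metric.diam P / polytopeWidth P / √(n : ℝ) + Metric.diam P / n *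
      ‖∑ i ∈ Finset.range n, (affineSpan ℝ P).direction.starProjection (b i - a)‖) :
    (inner ℝ a (subgradientAction P y (Metric.diam P * polytopeWidth P / (2 * L)) b n - xs) : ℝ)
      ≤ s ∧
    ((inner ℝ a (subgradientAction P y (Metric.diam P * polytopeWidth P / (2 * L)) b n - xs) : ℝ)
      = 0 ∨ suboptimalityGap P a ≤ s) := by
  have hW := polytopeWidth_pos hP.isCompact hP2
  have hD : 0 < Metric.diam P := hW.trans_le (polytopeWidth_le_diam hP.isCompact hP2)
  have hn' : (0 : ℝ) < n := by exact_mod_cast hn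
  have hsn : 0 < √(n : ℝ) := Real.sqrt_pos.2 hn'
  have key := inner_euclideanProj_sub_le hP (a := a) (b := (n : ℝ)⁻¹ • ∑ i ∈ Finset.range n, b i)
    (y := y) (xs := xs) (θ := Metric.diam P * polytopeWidth P / (2 * L) * √(n : ℝ))
    (by positivity) hy hxs
  have hproj : (affineSpan ℝ P).direction.starProjection
      ((n : ℝ)⁻¹ • ∑ i ∈ Finset.range n, b i - a) = (n : ℝ)⁻¹ •
        ∑ i ∈ Finset.range n, (affineSpan ℝ P).direction.starProjection (b i - a) := by
    rw [← map_sum, ← map_smul, Finset.sum_sub_distrib, smul_sub]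
    congr 2
    rw [Finset.sum_const, Finset.card_range, ← Nat.cast_smul_eq_nsmul ℝ, smul_smul,
      inv_mul_cancel₀ hn'.ne', one_smul]
  have hrhs : Metric.diam P ^ 2 / (Metric.diam P * polytopeWidth P / (2 * L) * √(n : ℝ)) +
      Metric.diam P * ‖(affineSpan ℝ P).direction.starProjection
        ((n : ℝ)⁻¹ • ∑ i ∈ Finset.range n, b i - a)‖ = s := by
    rw [hs, hproj, norm_smul, norm_inv, Real.norm_of_nonneg hn'.le]
    field_simp
  rw [hrhs, ← subgradientPoint_eq_sub_smul_average y _ b hn] at key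
  exact key

/-- `R` is left free because the bound is used twice, with the given `R` and with `2L`. The loss is
bounded in terms of `A` and `B` only, which makes both final comparisons numerical. -/
theorem expected_regret_le [IsProbabilityMeasure μ] (hP : IsPolytope P) (hP2 : P.Nontrivial)
    {a : ℕ → Ω → EuclideanSpace ℝ (Fin d)} {abar : EuclideanSpace ℝ (Fin d)}
    (hindep : iIndepFun a μ) (hint : ∀ n, Integrable (a n) μ) (hmean : ∀ n, ∫ ω, a n ω ∂μ = abar)
    {L R : ℝ} (hLpos : 0 < L) (hL : ∀ x ∈ P, ∀ y ∈ P, (inner ℝ abar (x - y) : ℝ) ≤ L)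
    (hR : ∀ n, ∀ᵐ ω ∂μ, ∀ x ∈ P, ∀ y ∈ P, |(inner ℝ (a n ω - abar) (x - y) : ℝ)| ≤ R)
    {y xs : EuclideanSpace ℝ (Fin d)} (hy : y ∈ P) (hxs : IsLinearMinimizer P abar xs)
    {D W A B : ℝ} (hD : D = Metric.diam P) (hW : W = polytopeWidth P)
    (hA : A = 2 * L * D / W) (hB : B = R * D / W)
    {r : ℕ → Ω → ℝ} (hr : ∀ n ω, r n ω =
      inner ℝ abar (subgradientAction P y (D * W / (2 * L)) (fun i => a i ω) n - xs)) :
    (∀ᵐ ω ∂μ, Summable fun n => r n ω) ∧ Integrable (fun ω => ∑' n, r n ω) μ ∧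
      ∫ ω, ∑' n, r n ω ∂μ ≤
        (25 / 4 * A ^ 2 + 12 * (A * B) + 23 / 2 * B ^ 2) / suboptimalityGap P abar := by
  have hWpos : 0 < W := hW ▸ polytopeWidth_pos hP.isCompact hP2
  have hWD : W ≤ D := hW ▸ hD ▸ polytopeWidth_le_diam hP.isCompact hP2
  have hDpos : 0 < D := hWpos.trans_le hWD
  -- From `W ≤ D`. This bounds both the loss of round `0` and the gap by `A / 2`.
  have hLA : L ≤ A / 2 := by
    rw [hA, le_div_iff₀ two_pos, le_div_iff₀ hWpos]
    nlinarith
  have hmem : ∀ n ω, subgradientAction P y (D * W / (2 * L)) (fun i => a i ω) n ∈ P :=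
    fun n ω => subgradientAction_mem hP _ _ _ _
  have hr0 : ∀ n ω, 0 ≤ r n ω := fun n ω => by
    rw [hr, inner_sub_right]
    exact sub_nonneg.2 (hxs.2 _ (hmem n ω))
  have hrL : ∀ n ω, r n ω ≤ L := fun n ω => hr n ω ▸ hL _ (hmem n ω) _ hxs.1
  have hri : ∀ n, Integrable (r n) μ := fun n => by
    refine Integrable.of_bound (C := L) ?_ (Filter.Eventually.of_forall fun ω => ?_)
    · have hm : AEMeasurable (fun ω i => a i ω) μ :=
        aemeasurable_pi_lambda _ fun i => (hint i).aemeasurable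
      have hcont : Continuous fun b : ℕ → EuclideanSpace ℝ (Fin d) =>
          (inner ℝ abar (subgradientAction P y (D * W / (2 * L)) b n - xs) : ℝ) := by
        have := (continuous_euclideanProj hP.isCompact hP.nonempty hP.convex).comp
          (continuous_subgradientPoint y (D * W / (2 * L)) n)
        exact continuous_const.inner (this.sub continuous_const)
      rw [show r n = _ from funext (hr n)]
      exact (hcont.measurable.comp_aemeasurable hm).aestronglyMeasurable
    · rw [Real.norm_of_nonneg (hr0 n ω)]
      exact hrL n ω
  refine integral_tsum_le_of_sum_range_le hr0 hri ?_
  rcases suboptimalityGap_cases hP hxs hL with ⟨hgap, hzero⟩ | ⟨hgap, hgapL⟩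
  -- If the gap is `0`, all losses vanish, matching the bound read with division by zero.
  · intro m
    simp [hgap, hr, hzero _ (hmem _ _)]
  set ρ := R / W with hρ
  have hBρ : B = D * ρ := by rw [hB, hρ]; ring
  set ξ : ℕ → Ω → EuclideanSpace ℝ (Fin d) := fun n ω =>
    (affineSpan ℝ P).direction.starProjection (a n ω - abar) with hξ
  have hξc : Continuous fun u : EuclideanSpace ℝ (Fin d) =>
    (affineSpan ℝ P).direction.starProjection (u - abar) := by fun_prop
  have hξm : ∀ n, AEMeasurable (ξ n) μ := fun n =>
    hξc.measurable.comp_aemeasurable (hint n).aemeasurable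
  have hξi : iIndepFun ξ μ := hindep.comp _ fun _ => hξc.measurable
  have hξb : ∀ n, ∀ᵐ ω ∂μ, ‖ξ n ω‖ ≤ ρ := fun n => by
    filter_upwards [hR n] with ω hω
    rw [hρ, le_div_iff₀ hWpos, hW]
    exact norm_starProjection_mul_polytopeWidth_le hP.isCompact hP.nonempty
      fun x hx y hy => (le_abs_self _).trans (hω x hx y hy)
  have hξ0 : ∀ n, ∫ ω, ξ n ω ∂μ = 0 := fun n => by
    have h := (affineSpan ℝ P).direction.starProjection.integral_comp_comm
      (φ := fun ω => a n ω - abar) ((hint n).sub (integrable_const _))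
    rw [integral_sub (hint n) (integrable_const _), hmean] at h
    simpa [hξ] using h
  have hρ0 : 0 ≤ ρ := by
    obtain ⟨ω, hω⟩ := (hξb 0).exists
    exact (norm_nonneg _).trans hω
  have hB0 : 0 ≤ B := by rw [hBρ]; positivity
  have hX : ∀ n k : ℕ, Integrable
      (fun ω => (D / n * ‖∑ i ∈ Finset.range n, ξ i ω‖) ^ k) μ := fun n k => by
    refine Integrable.of_bound (C := (D / n * (n * ρ)) ^ k) ?_ ?_
    · exact (((Finset.aemeasurable_fun_sum _ fun i _ => hξm i).norm.const_mul _).pow_const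
        k).aestronglyMeasurable
    · filter_upwards [ae_norm_sum_range_le hξb n] with ω hω
      rw [Real.norm_of_nonneg (by positivity)]
      gcongr
  have hround : ∀ n : ℕ, 0 < n → ∫ ω, r n ω ∂μ ≤ A / √(n : ℝ) + B / √(n : ℝ) ∧
      (A / √(n : ℝ) ≤ suboptimalityGap P abar / 2 → ∫ ω, r n ω ∂μ ≤
        16 / suboptimalityGap P abar ^ 3 * (3 * B ^ 4 / (n : ℝ) ^ 2)) := by
    intro n hn
    have hn' : (0 : ℝ) < n := by exact_mod_cast hn
    have hstep := fun ω => inner_subgradientAction_sub_le hP hP2 (fun i => a i ω) hLpos hy hxs hn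
      (s := A / √(n : ℝ) + D / n * ‖∑ i ∈ Finset.range n, ξ i ω‖) (by rw [hA, hD, hW])
    rw [← hD, ← hW] at hstep
    simp only [← hr] at hstep
    have hmom := integral_norm_sum_range_pow_le hξm hξi hξb hξ0 n
    refine integral_le_of_gap (hr0 n) (fun ω => (hstep ω).1) (fun ω => (hstep ω).2) hgap
      (fun ω => by positivity) (hX n) (by positivity) ?_ ?_
    · simp only [mul_pow, integral_const_mul]
      calc (D / n) ^ 2 * ∫ ω, ‖∑ i ∈ Finset.range n, ξ i ω‖ ^ 2 ∂μ
          ≤ (D / n) ^ 2 * (n * ρ ^ 2) := by gcongr; exact hmom.1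
        _ = (B / √(n : ℝ)) ^ 2 := by
            rw [div_pow B, Real.sq_sqrt hn'.le, hBρ]
            field_simp
    · simp only [mul_pow, integral_const_mul]
      calc (D / n) ^ 4 * ∫ ω, ‖∑ i ∈ Finset.range n, ξ i ω‖ ^ 4 ∂μ
          ≤ (D / n) ^ 4 * (3 * n ^ 2 * ρ ^ 4) := by gcongr; exact hmom.2
        _ = 3 * B ^ 4 / (n : ℝ) ^ 2 := by
            rw [hBρ]
            field_simp
  refine sum_range_le_of_two_regimes hgap (hgapL.trans hLA) hB0 ?_
    (fun n => integral_nonneg (hr0 n)) (fun n hn => ?_) (fun n hn h => ?_)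
  · refine le_trans ?_ hLA
    calc ∫ ω, r 0 ω ∂μ ≤ ∫ _, L ∂μ := integral_mono (hri 0) (integrable_const _) (hrL 0)
      _ = L := by simp
  · refine (hround n hn).1.trans_eq ?_
    ring
  · refine ((hround n hn).2 h).trans_eq ?_
    ring

end Regret

theorem theorem4 {d : ℕ} {Ω : Type*} [MeasurableSpace Ω] (μ : Measure Ω) [IsProbabilityMeasure μ]
    (P : Set (EuclideanSpace ℝ (Fin d))) (hP : IsPolytope P) (hP2 : P.Nontrivial)
    (a : ℕ → Ω → EuclideanSpace ℝ (Fin d)) (abar : EuclideanSpace ℝ (Fin d))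
    (hindep : iIndepFun a μ) (hident : ∀ n, IdentDistrib (a n) (a 0) μ μ)
    (hint : Integrable (a 0) μ) (hmean : ∫ ω, a 0 ω ∂μ = abar)
    (L R : ℝ) (hLpos : 0 < L)
    (hL : ∀ n, ∀ᵐ ω ∂μ, ∀ x ∈ P, ∀ y ∈ P, |(inner ℝ (a n ω) (x - y) : ℝ)| ≤ L)
    (hR : ∀ n, ∀ᵐ ω ∂μ, ∀ x ∈ P, ∀ y ∈ P, |(inner ℝ (a n ω - abar) (x - y) : ℝ)| ≤ R)
    (y₁ : EuclideanSpace ℝ (Fin d)) (hy₁ : y₁ ∈ P)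
    (D W Δ η : ℝ) (hD : D = Metric.diam P) (hW : W = polytopeWidth P)
    (hΔ : Δ = suboptimalityGap P abar) (hη : η = D * W / (2 * L))
    (xstar : EuclideanSpace ℝ (Fin d)) (hxstar : IsLinearMinimizer P abar xstar)
    (x : ℕ → Ω → EuclideanSpace ℝ (Fin d))
    (hx : ∀ n ω, x n ω = subgradientAction P y₁ η (fun i => a i ω) n) :
    (∀ᵐ ω ∂μ, Summable fun n => (inner ℝ abar (x n ω - xstar) : ℝ)) ∧
    Integrable (fun ω => ∑' n, (inner ℝ abar (x n ω - xstar) : ℝ)) μ ∧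
    ∫ ω, ∑' n, (inner ℝ abar (x n ω - xstar) : ℝ) ∂μ ≤
      (2 * L * D / W + Real.sqrt (Real.pi / 2) * (R * D / W)) *
          (30 * L * D / (W * Δ) + 1 / 3) +
        15 * R ^ 2 * D ^ 2 / (W ^ 2 * Δ) ∧
    ∫ ω, ∑' n, (inner ℝ abar (x n ω - xstar) : ℝ) ∂μ ≤
      200 * (L ^ 2 * D ^ 2 / (W ^ 2 * Δ)) := by
  have hint' : ∀ n, Integrable (a n) μ := fun n => (hident n).integrable_iff.2 hint
  have hmean' : ∀ n, ∫ ω, a n ω ∂μ = abar := fun n => (hident n).integral_eq.trans hmean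
  have hLbar : ∀ x ∈ P, ∀ y ∈ P, |(inner ℝ abar (x - y) : ℝ)| ≤ L := fun x hx y hy => by
    rw [← hmean, real_inner_comm, ← integral_inner hint, ← Real.norm_eq_abs]
    refine (norm_integral_le_of_norm_le_const (C := L) ?_).trans (by simp)
    filter_upwards [hL 0] with ω hω
    rw [Real.norm_eq_abs, real_inner_comm]
    exact hω x hx y hy
  have hLbar' : ∀ x ∈ P, ∀ y ∈ P, (inner ℝ abar (x - y) : ℝ) ≤ L := fun x hx y hy =>
    (le_abs_self _).trans (hLbar x hx y hy)
  -- The deviations are always bounded by `2L`, so the last bound needs no comparison of `R` with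
  -- `L`.
  have hR2L : ∀ n, ∀ᵐ ω ∂μ, ∀ x ∈ P, ∀ y ∈ P,
      |(inner ℝ (a n ω - abar) (x - y) : ℝ)| ≤ 2 * L := fun n => by
    filter_upwards [hL n] with ω hω x hx y hy
    rw [inner_sub_left]
    refine (abs_sub _ _).trans ?_
    linarith [hω x hx y hy, hLbar x hx y hy]
  have hWpos : 0 < W := hW ▸ polytopeWidth_pos hP.isCompact hP2
  have hWD : W ≤ D := hW ▸ hD ▸ polytopeWidth_le_diam hP.isCompact hP2
  have hDpos : 0 < D := hWpos.trans_le hWD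
  have hR0 : 0 ≤ R := by
    obtain ⟨ω, hω⟩ := (hR 0).exists
    exact (abs_nonneg _).trans (hω y₁ hy₁ y₁ hy₁)
  have hΔ0 : 0 ≤ Δ := by
    rcases suboptimalityGap_cases hP hxstar hLbar' with h | h
    · exact (hΔ.trans h.1).ge
    · exact hΔ ▸ h.1.le
  have hreg := fun (R : ℝ) hR => expected_regret_le (μ := μ) (R := R) hP hP2 hindep hint' hmean'
    hLpos hLbar' hR hy₁ hxstar hD hW rfl rfl
    (r := fun n ω => (inner ℝ abar (x n ω - xstar) : ℝ)) (fun n ω => by rw [hx, hη])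
  rw [← hΔ] at hreg
  obtain ⟨hsum, hintegrable, hle⟩ := hreg R hR
  refine ⟨hsum, hintegrable, hle.trans ?_, (hreg (2 * L) hR2L).2.2.trans ?_⟩
  -- Only `√(π/2) ≥ 1` is needed, and the summand `1/3` is slack.
  · have hpi : 1 ≤ √(Real.pi / 2) := by
      rw [Real.one_le_sqrt]
      linarith [Real.pi_gt_three]
    set A := 2 * L * D / W with hA
    set B := R * D / W with hB
    have hA0 : 0 ≤ A := by positivity
    have hB0 : 0 ≤ B := by positivity
    have e1 : 30 * L * D / (W * Δ) = 15 * A / Δ := by rw [hA]; ring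
    have e2 : 15 * R ^ 2 * D ^ 2 / (W ^ 2 * Δ) = 15 * B ^ 2 / Δ := by rw [hB]; ring
    rw [e1, e2]
    calc (25 / 4 * A ^ 2 + 12 * (A * B) + 23 / 2 * B ^ 2) / Δ
        ≤ (15 * A ^ 2 + 15 * (A * B) + 15 * B ^ 2) / Δ := by
          gcongr <;> norm_num
      _ = (A + 1 * B) * (15 * A / Δ + 0) + 15 * B ^ 2 / Δ := by ring
      _ ≤ (A + √(Real.pi / 2) * B) * (15 * A / Δ + 1 / 3) + 15 * B ^ 2 / Δ := by
          gcongr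
          norm_num
  -- With `R = 2L` one has `B = A`, and `4 (25/4 + 12 + 23/2) = 119`.
  · calc _ = 119 * (L ^ 2 * D ^ 2 / (W ^ 2 * Δ)) := by ring
      _ ≤ 200 * (L ^ 2 * D ^ 2 / (W ^ 2 * Δ)) := by
        gcongr
        norm_num
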